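/- For a probability measure $\mu$ on $\mathbb{R}$ let $G_\mu(z)=\int\frac{\mu(dx)}{z-x}$ and $K_\mu(z)=z-\frac{1}{G_\mu(z)}$ for $z\in\mathbb{C}^+$. For $\alpha>0$, the additive Boolean convolution power $\mu^{\uplus\alpha}$ is the probability measure with $K_{\mu^{\uplus\alpha}}=\alpha K_\mu$ on $\mathbb{C}^+$, and $D_r(\mu)$ is the image of $\mu$ under $x\mapsto rx$. If $\mu$ is non-degenerate with support bounded above, put $B(\mu)=\max\{0,\sup\operatorname{supp}\mu\}$, $\theta_+=1/B(\mu)\in(0,\infty]$ and, for $\theta\in(0,\theta_+)$, $M_\mu(\theta)=\int\frac{\mu(dx)}{1-\theta x}$ and $P_{(\theta,\mu)}(dx)=\frac{\mu(dx)}{M_\mu(\theta)(1-\theta x)}$. The probability measures $P_{(\theta,\mu)}$ form the one-sided Cauchy-Stieltjes kernel (CSK) family generated by $\mu$. Their mean $k_\mu(\theta)=\int x\,P_{(\theta,\mu)}(dx)$ is strictly increasing in $\theta$; the interval $k_\mu((0,\theta_+))$ is the domain of means, with lower end $m_0(\mu)=\lim_{\theta\to0^+}k_\mu(\theta)\in[-\infty,\infty)$.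 If $\psi_\mu$ is the inverse of $k_\mu$ on the domain of means, the pseudo-variance function of the family is $\mathbb{V}_\mu(m)=m\left(\frac{1}{\psi_\mu(m)}-m\right)$. **Proposition.** Let $\nu$ be a non-degenerate probability measure on $\mathbb{R}$ with support bounded above, let $m_0=m_0(\nu)$, and let $\alpha>0$. Then $\nu^{\uplus\alpha}$ exists, the measure $\nu_\alpha=D_{1/\alpha}(\nu^{\uplus\alpha})$ is non-degenerate and has support bounded above, and there is a real $c>m_0$ (so $c=m_0+\varepsilon$ with $\varepsilon>0$ if $m_0$ is finite) such that every $m\in(m_0,c)$ lies in the domains of means of both $\nu$ and $\nu_\alpha$ and satisfies $$\mathbb{V}_{\nu_\alpha}(m)=\frac{\mathbb{V}_\nu(m)}{\alpha}+\left(\frac1\alpha-1\right)m^2 .$$ -/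

import Mathlib

open MeasureTheory Set Filter Topology

noncomputable section

namespace CSK

/-- The number `B(ν) = max {0, sup supp ν}`. -/
def boundB (ν : Measure ℝ) : ℝ := max 0 (sSup ν.support)

/-- The parameter interval `(0, θ₊)` with `1 / θ₊ = B(ν)`, where `θ₊ = ∞` if `B(ν) = 0`. -/
def paramSet (ν : Measure ℝ) : Set ℝ := {θ | 0 < θ ∧ θ * boundB ν < 1}

/-- The normalizing constant `M_ν(θ) = ∫ 1 / (1 - θ x) ν(dx)`. -/
def normConst (ν : Measure ℝ) (θ : ℝ) : ℝ := ∫ x, 1 / (1 - θ * x) ∂ν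

/-- The member `P_{(θ,ν)}(dx) = ν(dx) / (M_ν(θ) (1 - θ x))` of the one-sided Cauchy-Stieltjes
kernel family generated by `ν`, for `θ` in `paramSet ν`. -/
def member (ν : Measure ℝ) (θ : ℝ) : Measure ℝ :=
  ν.withDensity fun x => ENNReal.ofReal (1 / (normConst ν θ * (1 - θ * x)))

/-- The mean `k_ν(θ) = ∫ x P_{(θ,ν)}(dx)`. -/
def meanFun (ν : Measure ℝ) (θ : ℝ) : ℝ := ∫ x, x ∂(member ν θ)

/-- The lower end `m₀(ν) = lim_{θ → 0⁺} k_ν(θ)` of the domain of means, possibly `-∞`. -/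
def lowerMean (ν : Measure ℝ) : EReal := limUnder (𝓝[>] (0 : ℝ)) fun θ => (meanFun ν θ : EReal)

/-- The one-sided domain of means: the image of `(0, θ₊)` under `k_ν`. -/
def meanDomain (ν : Measure ℝ) : Set ℝ := meanFun ν '' paramSet ν

/-- The inverse `ψ_ν` of `k_ν : (0, θ₊) → meanDomain ν`. -/
def meanInv (ν : Measure ℝ) : ℝ → ℝ := Function.invFunOn (meanFun ν) (paramSet ν)

/-- The pseudo-variance function, given on the domain of means by
`𝕍_ν(m) / m = 1 / ψ_ν(m) - m`. -/
def pseudoVar (ν : Measure ℝ) (m : ℝ) : ℝ := m * (1 / meanInv ν m - m)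

/-- The Cauchy transform `G_μ(z) = ∫ 1 / (z - x) μ(dx)`. -/
def cauchyTransform (μ : Measure ℝ) (z : ℂ) : ℂ := ∫ x : ℝ, 1 / (z - (x : ℂ)) ∂μ

/-- The self energy `K_μ(z) = z - 1 / G_μ(z)`. -/
def selfEnergy (μ : Measure ℝ) (z : ℂ) : ℂ := z - 1 / cauchyTransform μ z

/-- `μ` is the additive Boolean convolution power of `ν` with exponent `α`: it is a
probability measure whose self energy on the upper half plane is `α` times that of `ν`. -/
structure IsBooleanPow (ν : Measure ℝ) (α : ℝ) (μ : Measure ℝ) : Prop where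
  isProbabilityMeasure : IsProbabilityMeasure μ
  selfEnergy_eq : ∀ z : ℂ, 0 < z.im → selfEnergy μ z = (α : ℂ) * selfEnergy ν z

/-- The dilation `D_r(μ)`: the law of `r X` when `X` has law `μ`. -/
def dilation (r : ℝ) (μ : Measure ℝ) : Measure ℝ := μ.map fun x => r * x

/-- A measure is non-degenerate if it is not a point mass. -/
def NonDegenerate (ν : Measure ℝ) : Prop := ∀ a : ℝ, ν ≠ Measure.dirac a

end CSK

end

noncomputable section

namespace CSK

/-! Everything reduces to the self energy on the real axis. To the right of the support, `k_ν(θ) =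
K_ν(1/θ)` (`meanFun_eq`), and `K_ν` is continuous and strictly decreasing there
(`strictAntiOn_realK`). So for `m = K_ν(w)` one has `ψ_ν(m) = 1/w` and `𝕍_ν(m) = m (w - m)`. With `μ
= ν^{⊎α}`, dilation gives `K_{ν_α}(w/α) = K_μ(w)/α = K_ν(w)` for large `w`, so `m` is also the mean
of the second family at parameter `α/w`, and `𝕍_{ν_α}(m) = m (w/α - m)`, which is the claim.

Two analytic facts are needed. The power exists: for finitely supported `ν` it is the spectral
measure of an explicit matrix, and the general case follows by approximation and tightness
(`exists_isBooleanPow`). The relation `K_μ = α K_ν`, given only on the upper half plane, descends to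
real `w` near `+∞`: boundary values of `G_μ` are real there, so `μ` has no mass there
(`ae_le_of_tendsto_im`, `exists_realK_isBooleanPow`). -/

theorem norm_inv_sub_le (z : ℂ) (hz : 0 < z.im) (x : ℝ) : ‖1 / (z - (x : ℂ))‖ ≤ 1 / z.im := by
  rw [norm_div, norm_one]
  apply one_div_le_one_div_of_le hz
  have := Complex.abs_im_le_norm (z - (x : ℂ))
  simp only [Complex.sub_im, Complex.ofReal_im, sub_zero] at this
  exact (le_abs_self _).trans this

theorem sub_ofReal_ne_zero {z : ℂ} (hz : 0 < z.im) (x : ℝ) : z - (x : ℂ) ≠ 0 := by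
  intro h
  have := congrArg Complex.im h
  simp at this
  exact hz.ne' this

theorem continuous_inv_sub {z : ℂ} (hz : 0 < z.im) : Continuous fun x : ℝ => 1 / (z - (x : ℂ)) :=
  continuous_const.div (continuous_const.sub Complex.continuous_ofReal) (sub_ofReal_ne_zero hz)

theorem integrable_inv_sub (μ : Measure ℝ) [IsFiniteMeasure μ] {z : ℂ} (hz : 0 < z.im) :
    Integrable (fun x : ℝ => 1 / (z - (x : ℂ))) μ :=
  Integrable.of_bound (continuous_inv_sub hz).aestronglyMeasurable (1 / z.im)
    (ae_of_all _ (norm_inv_sub_le z hz))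

theorem im_inv_sub (z : ℂ) (x : ℝ) :
    (1 / (z - (x : ℂ))).im = -(z.im / ((z.re - x) ^ 2 + z.im ^ 2)) := by
  rw [one_div, Complex.inv_im, Complex.normSq_apply]
  simp only [Complex.sub_im, Complex.ofReal_im, sub_zero, Complex.sub_re, Complex.ofReal_re]
  ring

theorem im_cauchyTransform (μ : Measure ℝ) [IsFiniteMeasure μ] {z : ℂ} (hz : 0 < z.im) :
    (cauchyTransform μ z).im = -∫ x, z.im / ((z.re - x) ^ 2 + z.im ^ 2) ∂μ := by
  have h := integral_im (𝕜 := ℂ) (integrable_inv_sub μ hz)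
  rw [← integral_neg]
  simp only [cauchyTransform]
  refine h.symm.trans (integral_congr_ae (ae_of_all _ fun x => ?_))
  exact im_inv_sub z x

theorem integrable_poisson (μ : Measure ℝ) [IsFiniteMeasure μ] {z : ℂ} (hz : 0 < z.im) :
    Integrable (fun x : ℝ => z.im / ((z.re - x) ^ 2 + z.im ^ 2)) μ := by
  refine ((integrable_inv_sub μ hz).im.neg).congr (ae_of_all _ fun x => ?_)
  have := im_inv_sub z x
  simp only [Pi.neg_apply]
  change -(1 / (z - (x : ℂ))).im = _
  rw [this, neg_neg]

theorem im_cauchyTransform_neg (μ : Measure ℝ) [IsProbabilityMeasure μ] {z : ℂ} (hz : 0 < z.im) :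
    (cauchyTransform μ z).im < 0 := by
  rw [im_cauchyTransform μ hz, neg_lt_zero]
  have hpos : ∀ x : ℝ, 0 < z.im / ((z.re - x) ^ 2 + z.im ^ 2) := fun x => by positivity
  rw [integral_pos_iff_support_of_nonneg (fun x => (hpos x).le) (integrable_poisson μ hz)]
  have : Function.support (fun x : ℝ => z.im / ((z.re - x) ^ 2 + z.im ^ 2)) = univ :=
    eq_univ_of_forall fun x => (hpos x).ne'
  rw [this]; simp

theorem cauchyTransform_ne_zero (μ : Measure ℝ) [IsProbabilityMeasure μ] {z : ℂ} (hz : 0 < z.im) :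
    cauchyTransform μ z ≠ 0 := fun h => by
  have := im_cauchyTransform_neg μ hz
  simp [h] at this

/-! ### Boolean powers of finitely supported measures -/

/-- The spectral measure of a symmetric operator in finite dimension at a unit vector. -/
theorem exists_spectralMeasure {E : Type*} [NormedAddCommGroup E] [InnerProductSpace ℂ E]
    [FiniteDimensional ℂ E] (T : E →ₗ[ℂ] E) (hT : T.IsSymmetric) (v : E) (hv : ‖v‖ = 1) :
    ∃ μ : Measure ℝ, IsProbabilityMeasure μ ∧ ∀ z : ℂ, 0 < z.im →
      ∃ w : E, z • w - T w = v ∧ cauchyTransform μ z = inner ℂ v w := by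
  classical
  let u := hT.eigenvectorBasis rfl
  let l := hT.eigenvalues rfl
  let q : Fin (Module.finrank ℂ E) → ℝ := fun j => ‖inner ℂ (u j) v‖ ^ 2
  have hq : ∀ j, 0 ≤ q j := fun j => sq_nonneg _
  have hq1 : ∑ j, q j = 1 := by
    rw [u.sum_sq_norm_inner_right v, hv, one_pow]
  refine ⟨∑ j, ENNReal.ofReal (q j) • Measure.dirac (l j), ⟨?_⟩, fun z hz => ?_⟩
  · simp only [Measure.coe_finsetSum, Finset.sum_apply, Measure.smul_apply, measure_univ,
      smul_eq_mul, mul_one]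
    rw [← ENNReal.ofReal_sum_of_nonneg fun j _ => hq j, hq1, ENNReal.ofReal_one]
  · refine ⟨∑ j, (inner ℂ (u j) v / (z - l j)) • u j, ?_, ?_⟩
    · rw [map_sum, Finset.smul_sum, ← Finset.sum_sub_distrib]
      conv_rhs => rw [← u.sum_repr' v]
      refine Finset.sum_congr rfl fun j _ => ?_
      have hTu : T (u j) = (l j : ℂ) • u j := hT.apply_eigenvectorBasis rfl j
      have hne := sub_ofReal_ne_zero hz (l j)
      rw [map_smul, hTu, smul_comm z, ← smul_sub, ← sub_smul, smul_smul, div_mul_cancel₀ _ hne]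
    · rw [cauchyTransform, integral_finsetSum_measure, inner_sum]
      · refine Finset.sum_congr rfl fun j _ => ?_
        rw [integral_smul_measure, integral_dirac, inner_smul_right, ENNReal.toReal_ofReal (hq j),
          ← inner_conj_symm v (u j), div_mul_eq_mul_div, Complex.mul_conj, Complex.normSq_eq_norm_sq]
        simp only [q, Complex.real_smul]
        push_cast
        ring
      · intro j _
        have := integrable_inv_sub (Measure.dirac (l j)) hz
        exact this.smul_measure ENNReal.ofReal_ne_top

/-- The Boolean convolution power of a finitely supported measure. -/
theorem exists_booleanPow_finite {ι : Type*} [Fintype ι] (x p : ι → ℝ) (hp : ∀ i, 0 ≤ p i)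
    (hp1 : ∑ i, p i = 1) {α : ℝ} (hα : 0 < α) :
    ∃ μ : Measure ℝ, IsProbabilityMeasure μ ∧ ∀ z : ℂ, 0 < z.im →
      (α : ℂ) * cauchyTransform μ z =
        ((α - 1) * (z * cauchyTransform μ z) + 1) * ∑ i, (p i : ℂ) * (1 / (z - x i)) := by
  classical
  let v : EuclideanSpace ℂ ι := WithLp.toLp 2 fun i => ((√(p i) : ℝ) : ℂ)
  have hvi : ∀ i, v i = ((√(p i) : ℝ) : ℂ) := fun i => rfl
  have inner_v : ∀ y : EuclideanSpace ℂ ι, inner ℂ v y = ∑ i, ((√(p i) : ℝ) : ℂ) * y i := by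
    intro y
    rw [PiLp.inner_apply]
    refine Finset.sum_congr rfl fun i _ => ?_
    rw [hvi, RCLike.inner_apply, Complex.conj_ofReal, mul_comm]
  have hvv : inner ℂ v v = 1 := by
    rw [inner_v]
    simp only [hvi]
    rw [← Complex.ofReal_one, ← hp1, Complex.ofReal_sum]
    exact Finset.sum_congr rfl fun i _ => by rw [← Complex.ofReal_mul, Real.mul_self_sqrt (hp i)]
  have hv : ‖v‖ = 1 := by
    have := inner_self_eq_norm_sq_to_K (𝕜 := ℂ) v
    rw [hvv] at this
    have h2 : ‖v‖ ^ 2 = 1 := Complex.ofReal_injective (by push_cast; exact this.symm)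
    nlinarith [norm_nonneg v]
  let s : ℝ := √α
  have hs2 : s * s = α := Real.mul_self_sqrt hα.le
  -- `A v = √α v`, and `A` is the identity on the orthogonal complement of `v`. Passing from `X` to
  -- `A X A` multiplies the `(v, v)` entry by `α` and the entries coupling `v` to its complement by
  -- `√α`; by the Schur complement formula the self energy at `v` is multiplied by `α`.
  let A : EuclideanSpace ℂ ι →ₗ[ℂ] EuclideanSpace ℂ ι :=
    LinearMap.id + ((s - 1 : ℝ) : ℂ) • ((innerₛₗ ℂ v).smulRight v)
  have hA : ∀ y, A y = y + (((s - 1 : ℝ) : ℂ) * inner ℂ v y) • v := fun y => by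
    simp [A, smul_smul]
  let X : EuclideanSpace ℂ ι →ₗ[ℂ] EuclideanSpace ℂ ι :=
    Matrix.toEuclideanLin (Matrix.diagonal fun i => (x i : ℂ))
  have hX : ∀ y i, X y i = (x i : ℂ) * y i := fun y i => by
    simp [X, Matrix.toLpLin_apply, Matrix.mulVec_diagonal]
  have hAs : A.IsSymmetric := fun y y' => by
    rw [hA, hA, inner_add_left, inner_add_right, inner_smul_left, inner_smul_right, map_mul,
      Complex.conj_ofReal, inner_conj_symm]
    ring
  have hXs : X.IsSymmetric := fun y y' => by
    rw [PiLp.inner_apply, PiLp.inner_apply]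
    refine Finset.sum_congr rfl fun i _ => ?_
    rw [hX, hX, RCLike.inner_apply, RCLike.inner_apply, map_mul, Complex.conj_ofReal]
    ring
  have hTs : (A ∘ₗ X ∘ₗ A).IsSymmetric := fun y y' => by
    simp only [LinearMap.comp_apply]
    rw [hAs, hXs, hAs]
  obtain ⟨μ, hμ, h⟩ := exists_spectralMeasure _ hTs v hv
  refine ⟨μ, hμ, fun z hz => ?_⟩
  obtain ⟨w, hw, hg⟩ := h z hz
  rw [hg]
  simp only [LinearMap.comp_apply] at hw
  set g : ℂ := inner ℂ v w with hgdef
  set y := A w with hy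
  set k : ℂ := inner ℂ v (X y) with hk
  have hAX : A (X y) = X y + (((s - 1 : ℝ) : ℂ) * k) • v := hA _
  have hvy : inner ℂ v y = s * g := by
    rw [hy, hA, inner_add_right, inner_smul_right, hvv, ← hgdef]
    push_cast; ring
  -- `e1` pairs the resolvent equation with `v`; `e2` is its coordinate form with `w` eliminated in
  -- favour of `y = A w`. Eliminating `k` from the two leaves `K_μ = α K_ν` cleared of denominators.
  have e1 : z * g - s * k = 1 := by
    have := congrArg (fun t => inner ℂ v t) hw
    simp only [inner_sub_right, hAX, inner_add_right, inner_smul_right, hvv, ← hgdef, ← hk] at this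
    rw [← this]; push_cast; ring
  have e2 : ∀ i, (z - x i) * y i = ((√(p i) : ℝ) : ℂ) * (1 + (s - 1) * (k + z * g)) := by
    intro i
    have h1 := congrArg (fun t : EuclideanSpace ℂ ι => t i) hw
    have h2 := congrArg (fun t : EuclideanSpace ℂ ι => t i) (hA w)
    simp only [hAX, PiLp.sub_apply, PiLp.add_apply, PiLp.smul_apply, smul_eq_mul, hX, hvi,
      ← hy, ← hgdef] at h1 h2
    push_cast at h1 h2
    linear_combination h1 + z * h2
  have e3 : (s : ℂ) * g = (1 + (s - 1) * (k + z * g)) * ∑ i, (p i : ℂ) * (1 / (z - x i)) := by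
    rw [← hvy, inner_v, Finset.mul_sum]
    refine Finset.sum_congr rfl fun i _ => ?_
    have hne := sub_ofReal_ne_zero hz (x i)
    have hpi : ((√(p i) : ℝ) : ℂ) * ((√(p i) : ℝ) : ℂ) = p i := by
      rw [← Complex.ofReal_mul, Real.mul_self_sqrt (hp i)]
    rw [← hpi]
    field_simp
    linear_combination ((√(p i) : ℝ) : ℂ) * e2 i
  have hs2' : (s : ℂ) * s = α := by exact_mod_cast hs2
  rw [← hs2']
  linear_combination (s : ℂ) * e3 + (s - 1) * (∑ i, (p i : ℂ) * (1 / (z - x i))) * (-e1)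

/-! ### Approximation, tightness and existence -/

theorem integral_comp_simpleFunc {F : Type*} [NormedAddCommGroup F] [NormedSpace ℝ F]
    [CompleteSpace F] (ν : Measure ℝ) [IsFiniteMeasure ν] (s : SimpleFunc ℝ ℝ) (g : ℝ → F) :
    ∫ x, g (s x) ∂ν = ∑ i : s.range, ν.real (s ⁻¹' {(i : ℝ)}) • g i := by
  classical
  have h : ∀ x, g (s x) = ∑ i ∈ s.range, (s ⁻¹' {i}).indicator (fun _ => g i) x := fun x => by
    rw [Finset.sum_eq_single_of_mem (s x) (s.mem_range_self x)]
    · rw [indicator_of_mem (by simp)]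
    · intro i _ hi
      exact indicator_of_notMem (fun h => hi (by simpa using Eq.symm h)) _
  simp_rw [h]
  rw [integral_finsetSum, Finset.sum_coe_sort s.range fun i => ν.real (s ⁻¹' {i}) • g i]
  · exact Finset.sum_congr rfl fun i _ => integral_indicator_const _ (s.measurableSet_fiber i)
  · exact fun i _ => (integrable_const _).indicator (s.measurableSet_fiber i)

theorem exists_booleanPow_simpleFunc (ν : Measure ℝ) [IsProbabilityMeasure ν]
    (s : SimpleFunc ℝ ℝ) {α : ℝ} (hα : 0 < α) :
    ∃ μ : Measure ℝ, IsProbabilityMeasure μ ∧ ∀ z : ℂ, 0 < z.im →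
      (α : ℂ) * cauchyTransform μ z =
        ((α - 1) * (z * cauchyTransform μ z) + 1) * ∫ x, 1 / (z - (s x : ℂ)) ∂ν := by
  have hsum : ∑ i : s.range, ν.real (s ⁻¹' {(i : ℝ)}) = 1 := by
    simpa using (integral_comp_simpleFunc ν s fun _ => (1 : ℝ)).symm
  obtain ⟨μ, hμ, h⟩ := exists_booleanPow_finite (fun i : s.range => (i : ℝ))
    (fun i => ν.real (s ⁻¹' {(i : ℝ)})) (fun i => measureReal_nonneg) hsum hα
  refine ⟨μ, hμ, fun z hz => ?_⟩
  rw [h z hz, integral_comp_simpleFunc ν s fun x => 1 / (z - (x : ℂ))]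
  simp only [Complex.real_smul]

theorem tendsto_integral_approx (ν : Measure ℝ) [IsProbabilityMeasure ν] {z : ℂ} (hz : 0 < z.im)
    (s : ℕ → SimpleFunc ℝ ℝ) (hs : ∀ x, Tendsto (fun n => s n x) atTop (𝓝 x)) :
    Tendsto (fun n => ∫ x, 1 / (z - (s n x : ℂ)) ∂ν) atTop (𝓝 (cauchyTransform ν z)) := by
  refine tendsto_integral_of_dominated_convergence (fun _ => 1 / z.im) (fun n => ?_)
    (integrable_const _) (fun n => ae_of_all _ fun x => norm_inv_sub_le z hz _)
    (ae_of_all _ fun x => ?_)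
  · exact ((continuous_inv_sub hz).measurable.comp (s n).measurable).aestronglyMeasurable
  · exact ((continuous_inv_sub hz).tendsto x).comp (hs x)

theorem poisson_I_eq {y : ℝ} (hy : 0 < y) (x : ℝ) :
    y * (y / ((0 - x) ^ 2 + y ^ 2)) = 1 - x ^ 2 / (x ^ 2 + y ^ 2) := by
  have : x ^ 2 + y ^ 2 ≠ 0 := by positivity
  have h2 : (0 - x) ^ 2 + y ^ 2 ≠ 0 := by simpa using this
  field_simp
  ring

/-- Markov's inequality for `x² / (x² + y²)`, which exceeds `1/2` when `|x| > y` and has integral `1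
- Re (iy G(iy))`. -/
theorem measure_norm_gt_le (μ : Measure ℝ) [IsProbabilityMeasure μ] {y : ℝ} (hy : 0 < y) :
    μ {x | y < ‖x‖} ≤
      ENNReal.ofReal (2 * (1 - (y * Complex.I * cauchyTransform μ (y * Complex.I)).re)) := by
  have hz : 0 < ((y : ℂ) * Complex.I).im := by simpa using hy
  have him := im_cauchyTransform μ hz
  have hint := integrable_poisson μ hz
  simp only [Complex.mul_im, Complex.ofReal_re, Complex.I_im, mul_one, Complex.ofReal_im,
    Complex.I_re, mul_zero, add_zero, Complex.mul_re, sub_self] at him hint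
  have hint2 := hint.const_mul y
  have hre : 1 - (y * Complex.I * cauchyTransform μ (y * Complex.I)).re =
      ∫ x, x ^ 2 / (x ^ 2 + y ^ 2) ∂μ := by
    have h1 : (y * Complex.I * cauchyTransform μ (y * Complex.I)).re =
        ∫ x, y * (y / ((0 - x) ^ 2 + y ^ 2)) ∂μ := by
      rw [integral_const_mul]
      simp [Complex.mul_re, him]
    have h2 : ∫ x, (1 : ℝ) ∂μ = 1 := by simp
    rw [h1, ← h2, ← integral_sub (integrable_const _) hint2]
    exact integral_congr_ae (ae_of_all _ fun x => by simp only [poisson_I_eq hy]; ring)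
  have hint3 : Integrable (fun x : ℝ => x ^ 2 / (x ^ 2 + y ^ 2)) μ :=
    ((integrable_const (1 : ℝ)).sub hint2).congr
      (ae_of_all _ fun x => by simp only [Pi.sub_apply, poisson_I_eq hy]; ring)
  have hmarkov := mul_meas_ge_le_integral_of_nonneg (μ := μ)
    (ae_of_all _ fun x : ℝ => (by positivity : (0 : ℝ) ≤ x ^ 2 / (x ^ 2 + y ^ 2))) hint3 (1 / 2)
  rw [hre]
  have hsub : {x : ℝ | y < ‖x‖} ⊆ {x | 1 / 2 ≤ x ^ 2 / (x ^ 2 + y ^ 2)} := fun x hx => by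
    have hx' : y < |x| := hx
    have : y ^ 2 < x ^ 2 := sq_lt_sq' (by linarith [abs_nonneg x]) hx' |>.trans_eq (sq_abs x)
    rw [mem_ofPred_eq, div_le_div_iff₀ (by norm_num) (by positivity)]
    linarith
  refine (measure_mono hsub).trans ?_
  rw [← ofReal_measureReal]
  exact ENNReal.ofReal_le_ofReal (by linarith)

theorem tendsto_mul_cauchyTransform (ν : Measure ℝ) [IsProbabilityMeasure ν] :
    Tendsto (fun y : ℝ => y * Complex.I * cauchyTransform ν (y * Complex.I)) atTop (𝓝 1) := by
  have h : Tendsto (fun y : ℝ => ∫ x : ℝ, y * Complex.I * (1 / (y * Complex.I - (x : ℂ))) ∂ν) atTop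
      (𝓝 (∫ _ : ℝ, (1 : ℂ) ∂ν)) := by
    refine tendsto_integral_filter_of_dominated_convergence (fun _ => 1) ?_ ?_
      (integrable_const _) (ae_of_all _ fun x => ?_)
    · filter_upwards [eventually_gt_atTop 0] with y hy
      have hz : 0 < ((y : ℂ) * Complex.I).im := by simpa using hy
      exact ((integrable_inv_sub ν hz).const_mul _).aestronglyMeasurable
    · filter_upwards [eventually_gt_atTop 0] with y hy
      have hz : 0 < ((y : ℂ) * Complex.I).im := by simpa using hy
      refine ae_of_all _ fun x => ?_
      have := norm_inv_sub_le _ hz x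
      rw [norm_mul]
      simp only [Complex.mul_im, Complex.ofReal_re, Complex.I_im, mul_one, Complex.ofReal_im,
        Complex.I_re, mul_zero, add_zero] at this
      have hn : ‖(y : ℂ) * Complex.I‖ = y := by simp [abs_of_pos hy]
      rw [hn]
      calc y * _ ≤ y * (1 / y) := by gcongr
        _ = 1 := by field_simp
    · have h1 : Tendsto (fun y : ℝ => (1 : ℂ) - (x : ℂ) / Complex.I * ((y⁻¹ : ℝ) : ℂ)) atTop
          (𝓝 (1 - (x : ℂ) / Complex.I * ((0 : ℝ) : ℂ))) :=
        tendsto_const_nhds.sub (tendsto_const_nhds.mul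
          ((Complex.continuous_ofReal.tendsto 0).comp tendsto_inv_atTop_zero))
      rw [Complex.ofReal_zero, mul_zero, sub_zero] at h1
      have h2 := h1.inv₀ one_ne_zero
      rw [inv_one] at h2
      refine h2.congr' ?_
      filter_upwards [eventually_gt_atTop 0] with y hy
      have hz : 0 < ((y : ℂ) * Complex.I).im := by simpa using hy
      have hne := sub_ofReal_ne_zero hz x
      have hy' : (y : ℂ) ≠ 0 := by exact_mod_cast hy.ne'
      rw [mul_one_div, inv_eq_iff_eq_inv, inv_div, sub_div, div_self (by simp [hy'])]
      push_cast
      field_simp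
  simp only [integral_const_mul] at h
  simpa [cauchyTransform] using h

/-- The relation `h` expresses `z G_{μ_n}(z)` as a Möbius function `f` of `z G_n(z)` with `f 1 = 1`.
Since `iy G_ν(iy) → 1`, the limiting tail bounds vanish as `y → ∞`. -/
theorem isTightMeasureSet_range_of_cauchyTransform {α : ℝ}
    (ν : Measure ℝ) [IsProbabilityMeasure ν] (G : ℕ → ℂ → ℂ)
    (hG : ∀ z : ℂ, 0 < z.im → Tendsto (fun n => G n z) atTop (𝓝 (cauchyTransform ν z)))
    (μ : ℕ → Measure ℝ) [∀ n, IsProbabilityMeasure (μ n)]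
    (h : ∀ n, ∀ z : ℂ, 0 < z.im → (α : ℂ) * cauchyTransform (μ n) z =
        ((α - 1) * (z * cauchyTransform (μ n) z) + 1) * G n z) :
    IsTightMeasureSet (range μ) := by
  refine isTightMeasureSet_range_of_tendsto_limsup_measure_norm_gt ?_
  let f : ℂ → ℂ := fun t => t / (α - (α - 1) * t)
  let T : ℝ → ℂ := fun y => y * Complex.I * cauchyTransform ν (y * Complex.I)
  have hT : Tendsto T atTop (𝓝 1) := tendsto_mul_cauchyTransform ν
  have hd : Tendsto (fun y => (α : ℂ) - (α - 1) * T y) atTop (𝓝 1) := by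
    have := (tendsto_const_nhds (x := (α : ℂ))).sub
      ((tendsto_const_nhds (x := (α : ℂ) - 1)).mul hT)
    simpa using this
  have hfT : Tendsto (fun y => f (T y)) atTop (𝓝 1) := by
    have := hT.div hd one_ne_zero
    rw [div_one] at this
    exact this
  have hlim : Tendsto (fun y => ENNReal.ofReal (2 * (1 - (f (T y)).re))) atTop (𝓝 0) := by
    have h1 := (Complex.continuous_re.tendsto 1).comp hfT
    have h2 := ((tendsto_const_nhds (x := (1 : ℝ))).sub h1).const_mul 2
    have h3 := ENNReal.tendsto_ofReal h2
    simpa using h3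
  refine tendsto_of_tendsto_of_tendsto_of_le_of_le' tendsto_const_nhds hlim
    (Eventually.of_forall fun _ => zero_le) ?_
  filter_upwards [hd.eventually_ne one_ne_zero, eventually_gt_atTop 0] with y hy hy0
  have hz : 0 < ((y : ℂ) * Complex.I).im := by simpa using hy0
  have hz0 : (y : ℂ) * Complex.I ≠ 0 := fun h0 => by simp [h0] at hz
  set z : ℂ := (y : ℂ) * Complex.I with hzdef
  have hGz : Tendsto (fun n => z * G n z) atTop (𝓝 (T y)) := (hG z hz).const_mul z
  have hden : Tendsto (fun n => (α : ℂ) - (α - 1) * (z * G n z)) atTop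
      (𝓝 (α - (α - 1) * T y)) := tendsto_const_nhds.sub (hGz.const_mul _)
  have hconv : Tendsto (fun n => z * cauchyTransform (μ n) z) atTop (𝓝 (f (T y))) := by
    refine (hGz.div hden hy).congr' ?_
    filter_upwards [hden.eventually_ne hy] with n hn
    rw [Pi.div_apply, div_eq_iff hn]
    linear_combination (-z) * h n z hz
  have hconv2 : Tendsto
      (fun n => ENNReal.ofReal (2 * (1 - (z * cauchyTransform (μ n) z).re))) atTop
      (𝓝 (ENNReal.ofReal (2 * (1 - (f (T y)).re)))) :=
    ENNReal.tendsto_ofReal ((tendsto_const_nhds.sub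
      ((Complex.continuous_re.tendsto _).comp hconv)).const_mul 2)
  rw [← hconv2.limsup_eq]
  exact limsup_le_limsup (Eventually.of_forall fun n => measure_norm_gt_le (μ n) hy0)

/-- The additive Boolean convolution power exists for every positive exponent. -/
theorem exists_isBooleanPow (ν : Measure ℝ) [IsProbabilityMeasure ν] {α : ℝ} (hα : 0 < α) :
    ∃ μ : Measure ℝ, IsBooleanPow ν α μ := by
  let s : ℕ → SimpleFunc ℝ ℝ := (stronglyMeasurable_id (α := ℝ)).approx
  have hs : ∀ x, Tendsto (fun n => s n x) atTop (𝓝 x) :=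
    (stronglyMeasurable_id (α := ℝ)).tendsto_approx
  choose μ hμ h using fun n => exists_booleanPow_simpleFunc ν (s n) hα
  have hG := fun (z : ℂ) (hz : 0 < z.im) => tendsto_integral_approx ν hz s hs
  have htight := isTightMeasureSet_range_of_cauchyTransform (α := α) ν _ hG μ h
  let P : ℕ → ProbabilityMeasure ℝ := fun n => ⟨μ n, hμ n⟩
  have hcomp : IsCompact (closure (range P)) :=
    isCompact_closure_of_isTightMeasureSet (htight.subset (by
      rintro _ ⟨_, ⟨n, rfl⟩, rfl⟩
      exact ⟨n, rfl⟩))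
  -- An ultrafilter replaces the extraction of a subsequence; the relation passes to the limit
  -- because `1 / (z - x)` is bounded and continuous in `x`.
  let U : Ultrafilter ℕ := Ultrafilter.of atTop
  have hU : (U : Filter ℕ) ≤ atTop := Ultrafilter.of_le atTop
  obtain ⟨μ', -, hμ'⟩ := hcomp.ultrafilter_le_nhds (U.map P)
    (.trans (by simp) (monotone_principal subset_closure))
  have hconv : Tendsto P U (𝓝 μ') := hμ'
  rw [ProbabilityMeasure.tendsto_iff_forall_integral_rclike_tendsto ℂ] at hconv
  refine ⟨μ', inferInstance, fun z hz => ?_⟩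
  let g : BoundedContinuousFunction ℝ ℂ :=
    BoundedContinuousFunction.ofNormedAddCommGroup _ (continuous_inv_sub hz) (1 / z.im)
      (norm_inv_sub_le z hz)
  have hg : Tendsto (fun n => cauchyTransform (μ n) z) U (𝓝 (cauchyTransform μ' z)) := hconv g
  have heq := tendsto_nhds_unique (hg.const_mul (α : ℂ))
    (((((hg.const_mul z).const_mul ((α : ℂ) - 1)).add_const 1).mul
      ((hG z hz).mono_left hU)).congr fun n => (h n z hz).symm)
  have h1 := cauchyTransform_ne_zero (μ' : Measure ℝ) hz
  have h2 := cauchyTransform_ne_zero ν hz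
  simp only [selfEnergy]
  field_simp
  linear_combination heq

/-! ### Self energy on the real axis and the mean function -/

/-- The Cauchy transform at a real point. -/
def realG (ν : Measure ℝ) (w : ℝ) : ℝ := ∫ x, 1 / (w - x) ∂ν

/-- The self energy at a real point. -/
def realK (ν : Measure ℝ) (w : ℝ) : ℝ := w - 1 / realG ν w

theorem ae_le_boundB {ν : Measure ℝ} (hb : BddAbove ν.support) : ∀ᵐ x ∂ν, x ≤ boundB ν := by
  filter_upwards [Measure.support_mem_ae (μ := ν)] with x hx
  exact (le_csSup hb hx).trans (le_max_right _ _)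

theorem bddAbove_support {ν : Measure ℝ} {b : ℝ} (h : ∀ᵐ x ∂ν, x ≤ b) : BddAbove ν.support :=
  bddAbove_Iic.mono (Measure.support_subset_of_isClosed isClosed_Iic h)

theorem boundB_nonneg (ν : Measure ℝ) : 0 ≤ boundB ν := le_max_left _ _

theorem mem_paramSet_iff {ν : Measure ℝ} {θ : ℝ} : θ ∈ paramSet ν ↔ 0 < θ ∧ boundB ν < θ⁻¹ := by
  refine and_congr_right fun hθ => ?_
  rw [← one_div, lt_div_iff₀ hθ, mul_comm]

theorem normConst_eq {ν : Measure ℝ} {θ : ℝ} (hθ : 0 < θ) : normConst ν θ = θ⁻¹ * realG ν θ⁻¹ := by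
  rw [normConst, realG, ← integral_const_mul]
  refine integral_congr_ae (ae_of_all _ fun x => ?_)
  have : 1 - θ * x = θ * (θ⁻¹ - x) := by field_simp
  simp only [this, one_div, mul_inv]

theorem eq_dirac_of_ae_eq {ν : Measure ℝ} [IsProbabilityMeasure ν] {a : ℝ}
    (h : ∀ᵐ x ∂ν, x = a) : ν = Measure.dirac a := by
  have h1 : ν.map (fun x => x) = ν.map (fun _ => a) := Measure.map_congr h
  rwa [Measure.map_id', Measure.map_const, measure_univ, one_smul] at h1

section

variable {ν : Measure ℝ} [IsProbabilityMeasure ν] {b : ℝ}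

theorem measurable_one_div_sub (w : ℝ) : Measurable fun x : ℝ => 1 / (w - x) :=
  measurable_const.div (measurable_const.sub measurable_id)

theorem norm_one_div_sub_le {w x : ℝ} (hw : b < w) (hx : x ≤ b) :
    ‖1 / (w - x)‖ ≤ 1 / (w - b) := by
  rw [Real.norm_of_nonneg (one_div_nonneg.2 (by linarith))]
  exact one_div_le_one_div_of_le (by linarith) (by linarith)

theorem integrable_one_div_sub (h : ∀ᵐ x ∂ν, x ≤ b) {w : ℝ} (hw : b < w) :
    Integrable (fun x => 1 / (w - x)) ν :=
  Integrable.of_bound (measurable_one_div_sub w).aestronglyMeasurable (1 / (w - b))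
    (h.mono fun _ hx => norm_one_div_sub_le hw hx)

theorem integral_pos_of_ae_pos {f : ℝ → ℝ} (hf : Integrable f ν) (h : ∀ᵐ x ∂ν, 0 < f x) :
    0 < ∫ x, f x ∂ν := by
  rw [integral_pos_iff_support_of_nonneg_ae (h.mono fun _ hx => hx.le) hf]
  have : Function.support f =ᵐ[ν] univ := eventuallyEq_univ.2 (h.mono fun _ hx => hx.ne')
  rw [measure_congr this, measure_univ]
  exact one_pos

theorem realG_pos (h : ∀ᵐ x ∂ν, x ≤ b) {w : ℝ} (hw : b < w) : 0 < realG ν w :=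
  integral_pos_of_ae_pos (integrable_one_div_sub h hw)
    (h.mono fun _ hx => one_div_pos.2 (by linarith))

theorem continuousOn_realG (h : ∀ᵐ x ∂ν, x ≤ b) : ContinuousOn (realG ν) (Ioi b) := by
  intro w hw
  have hw : b < w := hw
  refine ContinuousAt.continuousWithinAt ?_
  obtain ⟨a, hba, haw⟩ := exists_between hw
  refine tendsto_integral_filter_of_dominated_convergence (fun _ => 1 / (a - b))
    (Eventually.of_forall fun u => (measurable_one_div_sub u).aestronglyMeasurable) ?_
    (integrable_const _) ?_
  · filter_upwards [eventually_gt_nhds haw] with u hu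
    filter_upwards [h] with x hx
    refine (norm_one_div_sub_le (hba.trans hu) hx).trans ?_
    exact one_div_le_one_div_of_le (by linarith) (by linarith)
  · filter_upwards [h] with x hx
    exact tendsto_const_nhds.div (tendsto_id.sub_const x) (by change w - x ≠ 0; linarith)

theorem continuousOn_realK (h : ∀ᵐ x ∂ν, x ≤ b) : ContinuousOn (realK ν) (Ioi b) :=
  continuousOn_id.sub (continuousOn_const.div (continuousOn_realG h)
    fun _ hw => (realG_pos h hw).ne')

theorem tendsto_mul_realG (h : ∀ᵐ x ∂ν, x ≤ b) : Tendsto (fun w => w * realG ν w) atTop (𝓝 1) := by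
  have H : Tendsto (fun w : ℝ => ∫ x : ℝ, w * (1 / (w - x)) ∂ν) atTop
      (𝓝 (∫ _ : ℝ, (1 : ℝ) ∂ν)) := by
    refine tendsto_integral_filter_of_dominated_convergence (fun _ => 2)
      (Eventually.of_forall fun w =>
        ((measurable_one_div_sub w).const_mul w).aestronglyMeasurable) ?_
      (integrable_const _) (ae_of_all _ fun x => ?_)
    · filter_upwards [eventually_gt_atTop (2 * |b|)] with w hw
      filter_upwards [h] with x hx
      have hb := le_abs_self b
      have hb' := abs_nonneg b
      rw [mul_one_div, Real.norm_of_nonneg (div_nonneg (by linarith) (by linarith)),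
        div_le_iff₀ (by linarith)]
      linarith
    · have h1 : Tendsto (fun w : ℝ => 1 - x * w⁻¹) atTop (𝓝 (1 - x * 0)) :=
        tendsto_const_nhds.sub (tendsto_inv_atTop_zero.const_mul x)
      rw [mul_zero, sub_zero] at h1
      have h2 := h1.inv₀ one_ne_zero
      rw [inv_one] at h2
      refine h2.congr' ?_
      filter_upwards [eventually_gt_atTop 0, eventually_gt_atTop x] with w hw hwx
      have : w - x ≠ 0 := by linarith
      rw [mul_one_div, inv_eq_iff_eq_inv, inv_div]
      field_simp
  simp only [integral_const_mul] at H
  simpa [realG] using H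

/-- With `d = w' - w`, `f' = f / (1 + d f)` is an increasing function of `f`, so `f` and `f'` are
positively correlated: `∫ f f' > g g'`, strictly since `f` is not a.e. constant. As `d f f' = f -
f'`, this says `1/g' - 1/g > d`. -/
theorem strictAntiOn_realK (hν : NonDegenerate ν) (h : ∀ᵐ x ∂ν, x ≤ b) :
    StrictAntiOn (realK ν) (Ioi b) := by
  intro w hw w' hw' hlt
  have hw : b < w := hw
  have hw' : b < w' := hw'
  set g := realG ν w with hg
  set g' := realG ν w' with hg'
  have gpos : 0 < g := realG_pos h hw
  have gpos' : 0 < g' := realG_pos h hw'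
  set d := w' - w with hd
  have dpos : 0 < d := sub_pos.2 hlt
  let f : ℝ → ℝ := fun x => 1 / (w - x)
  let f' : ℝ → ℝ := fun x => 1 / (w' - x)
  have If : Integrable f ν := integrable_one_div_sub h hw
  have If' : Integrable f' ν := integrable_one_div_sub h hw'
  have hff : ∀ᵐ x ∂ν, d * (f x * f' x) = f x - f' x := by
    filter_upwards [h] with x hx
    have h1 : w - x ≠ 0 := by linarith
    have h2 : w' - x ≠ 0 := by linarith
    simp only [f, f', hd]
    field_simp
    ring
  -- `(f - g) * (φ f - φ g)` with `φ t = t / (1 + d * t)` and `f' = φ f`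
  let q : ℝ → ℝ := fun x => (f x - g) * (f' x - g / (1 + d * g))
  have hq : ∀ᵐ x ∂ν, q x = (f x - f' x) / d - g * f' x - g / (1 + d * g) * f x +
      g * (g / (1 + d * g)) := by
    filter_upwards [hff] with x hx
    rw [← hx, mul_div_cancel_left₀ _ dpos.ne']
    simp only [q]; ring
  have I1 : Integrable (fun x => (f x - f' x) / d) ν := (If.sub If').div_const d
  have I2 : Integrable (fun x => g * f' x) ν := If'.const_mul g
  have I3 : Integrable (fun x => g / (1 + d * g) * f x) ν := If.const_mul _
  have Iq' : Integrable (fun x => (f x - f' x) / d - g * f' x - g / (1 + d * g) * f x +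
      g * (g / (1 + d * g))) ν := ((I1.sub I2).sub I3).add (integrable_const _)
  have Iq : Integrable q ν := Iq'.congr (hq.mono fun x hx => hx.symm)
  have hint : ∫ x, q x ∂ν = (g - g') / d - g * g' := by
    have e1 : ∫ x, f x ∂ν = g := rfl
    have e2 : ∫ x, f' x ∂ν = g' := rfl
    have I12 : Integrable (fun x => (f x - f' x) / d - g * f' x) ν := I1.sub I2
    have I123 : Integrable (fun x => (f x - f' x) / d - g * f' x - g / (1 + d * g) * f x) ν :=
      I12.sub I3
    rw [integral_congr_ae hq, integral_add I123 (integrable_const _),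
      integral_sub I12 I3, integral_sub I1 I2, integral_div, integral_sub If If',
      integral_const_mul, integral_const_mul, e1, e2]
    simp only [integral_const, probReal_univ, one_smul]
    ring
  have hqeq : ∀ᵐ x ∂ν, q x = (f x - g) ^ 2 * ((1 / (1 + d * g)) * (f' x / f x)) := by
    filter_upwards [h] with x hx
    have h1 : 0 < w - x := by linarith
    have h2 : 0 < w' - x := by linarith
    have h3 : 1 + d * g ≠ 0 := by positivity
    simp only [q, f, f']
    have : w' - x = w - x + d := by rw [hd]; ring
    rw [this] at h2 ⊢
    field_simp
    ring
  have hfac : ∀ᵐ x ∂ν, 0 < (1 / (1 + d * g)) * (f' x / f x) := by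
    filter_upwards [h] with x hx
    have h1 : 0 < w - x := by linarith
    have h2 : 0 < w' - x := by linarith
    simp only [f, f']
    positivity
  have hq0 : 0 ≤ᵐ[ν] q := by
    filter_upwards [hqeq, hfac] with x h1 h2
    rw [h1]
    exact mul_nonneg (sq_nonneg _) h2.le
  have hpos : 0 < ∫ x, q x ∂ν := by
    refine (integral_nonneg_of_ae hq0).lt_of_ne' fun h0 => ?_
    rw [integral_eq_zero_iff_of_nonneg_ae hq0 Iq] at h0
    refine hν (w - 1 / g) (eq_dirac_of_ae_eq ?_)
    filter_upwards [h0, hqeq, hfac, h] with x h1 h2 h3 h4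
    have h5 : (f x - g) ^ 2 = 0 := by
      have : q x = 0 := h1
      rw [h2] at this
      exact (mul_eq_zero.1 this).resolve_right h3.ne'
    have h6 : 1 / (w - x) = g := sub_eq_zero.1 (pow_eq_zero_iff two_ne_zero |>.1 h5)
    rw [← h6, one_div_one_div]
    ring
  rw [hint, sub_pos, lt_div_iff₀ dpos] at hpos
  have : 1 / g' - 1 / g = (g - g') / (g * g') := by
    field_simp
  have h2 : d < 1 / g' - 1 / g := by
    rw [this, lt_div_iff₀ (by positivity)]
    linarith
  simp only [realK, ← hg, ← hg']
  linarith

/-- With `w = 1/θ` the density is `1 / (G(w) (w - x))`, and `x / (w - x) = w / (w - x) - 1`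
integrates to `w G(w) - 1`. -/
theorem meanFun_eq (hb : BddAbove ν.support) {θ : ℝ} (hθ : θ ∈ paramSet ν) :
    meanFun ν θ = realK ν θ⁻¹ := by
  obtain ⟨hθ0, hθ1⟩ := mem_paramSet_iff.1 hθ
  have h := ae_le_boundB hb
  have hg := realG_pos h hθ1
  have hM := normConst_eq (ν := ν) hθ0
  have hMpos : 0 < normConst ν θ := by rw [hM]; positivity
  have hden : ∀ᵐ x ∂ν, 0 < 1 - θ * x := by
    filter_upwards [h] with x hx
    have : 1 - θ * x = θ * (θ⁻¹ - x) := by field_simp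
    rw [this]
    exact mul_pos hθ0 (by linarith)
  rw [meanFun, member, integral_withDensity_eq_integral_toReal_smul (by fun_prop)
    (ae_of_all _ fun _ => ENNReal.ofReal_lt_top)]
  have : ∀ᵐ x ∂ν, (ENNReal.ofReal (1 / (normConst ν θ * (1 - θ * x)))).toReal • x =
      (realG ν θ⁻¹)⁻¹ * (θ⁻¹ * (1 / (θ⁻¹ - x)) - 1) := by
    filter_upwards [hden, h] with x hx hx'
    rw [ENNReal.toReal_ofReal (by positivity), hM, smul_eq_mul]
    have h1 : 1 - θ * x = θ * (θ⁻¹ - x) := by field_simp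
    have h2 : θ⁻¹ - x ≠ 0 := by linarith
    rw [h1]
    have h3 : θ⁻¹ * (1 / (θ⁻¹ - x)) - 1 = x / (θ⁻¹ - x) := by
      rw [mul_one_div, div_sub_one h2]
      congr 1
      ring
    rw [h3]
    have h4 : θ⁻¹ * realG ν θ⁻¹ * (θ * (θ⁻¹ - x)) = realG ν θ⁻¹ * (θ⁻¹ - x) := by
      rw [mul_mul_mul_comm, inv_mul_cancel₀ hθ0.ne', one_mul]
    rw [h4]
    field_simp
  rw [integral_congr_ae this, integral_const_mul,
    integral_sub ((integrable_one_div_sub h hθ1).const_mul _) (integrable_const _),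
    integral_const_mul]
  change _ * (θ⁻¹ * realG ν θ⁻¹ - _) = _
  simp only [integral_const, probReal_univ, one_smul, realK]
  rw [mul_sub, mul_one, mul_left_comm, inv_mul_cancel₀ hg.ne', mul_one, one_div]

theorem realK_mem_meanDomain (hb : BddAbove ν.support) {w : ℝ} (hw : boundB ν < w) :
    realK ν w ∈ meanDomain ν := by
  have hw0 : 0 < w := (boundB_nonneg ν).trans_lt hw
  have hm : w⁻¹ ∈ paramSet ν := mem_paramSet_iff.2 ⟨inv_pos.2 hw0, by rwa [inv_inv]⟩
  exact ⟨w⁻¹, hm, by rw [meanFun_eq hb hm, inv_inv]⟩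

theorem injOn_meanFun (hν : NonDegenerate ν) (hb : BddAbove ν.support) :
    InjOn (meanFun ν) (paramSet ν) := by
  intro θ hθ θ' hθ' he
  rw [meanFun_eq hb hθ, meanFun_eq hb hθ'] at he
  exact inv_injective ((strictAntiOn_realK hν (ae_le_boundB hb)).injOn
    (mem_paramSet_iff.1 hθ).2 (mem_paramSet_iff.1 hθ').2 he)

theorem pseudoVar_realK (hν : NonDegenerate ν) (hb : BddAbove ν.support) {w : ℝ}
    (hw : boundB ν < w) : pseudoVar ν (realK ν w) = realK ν w * (w - realK ν w) := by
  have hw0 : 0 < w := (boundB_nonneg ν).trans_lt hw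
  have hm : w⁻¹ ∈ paramSet ν := mem_paramSet_iff.2 ⟨inv_pos.2 hw0, by rwa [inv_inv]⟩
  have h1 : meanFun ν w⁻¹ = realK ν w := by rw [meanFun_eq hb hm, inv_inv]
  have h2 : meanInv ν (realK ν w) = w⁻¹ := by
    rw [← h1]
    exact (injOn_meanFun hν hb).leftInvOn_invFunOn hm
  rw [pseudoVar, h2, one_div, inv_inv]

theorem tendsto_realK_lowerMean (hν : NonDegenerate ν) (hb : BddAbove ν.support) :
    Tendsto (fun w => (realK ν w : EReal)) atTop (𝓝 (lowerMean ν)) := by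
  have hanti := (strictAntiOn_realK hν (ae_le_boundB hb)).antitoneOn
  -- Clamping the argument makes the function antitone on all of `ℝ`, so it converges in `EReal`,
  -- possibly to `-∞`; hence the `limUnder` in `lowerMean` is a genuine limit.
  let f : ℝ → EReal := fun w => (realK ν (max w (boundB ν + 1)) : EReal)
  have hf : Antitone f := fun u v huv => by
    refine EReal.coe_le_coe_iff.2 (hanti ?_ ?_ (max_le_max_right _ huv)) <;>
    exact (lt_add_one (boundB ν)).trans_le (le_max_right _ _)
  have h1 : Tendsto (fun w => (realK ν w : EReal)) atTop (𝓝 (⨅ w, f w)) := by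
    refine (tendsto_atTop_iInf hf).congr' ?_
    filter_upwards [eventually_ge_atTop (boundB ν + 1)] with w hw
    simp only [f, max_eq_left hw]
  have h2 : Tendsto (fun θ => (meanFun ν θ : EReal)) (𝓝[>] (0 : ℝ)) (𝓝 (⨅ w, f w)) := by
    refine (h1.comp tendsto_inv_nhdsGT_zero).congr' ?_
    filter_upwards [tendsto_inv_nhdsGT_zero.eventually_gt_atTop (boundB ν),
      self_mem_nhdsWithin] with θ h3 h4
    rw [Function.comp_apply, meanFun_eq hb (mem_paramSet_iff.2 ⟨h4, h3⟩)]
  rw [lowerMean, h2.limUnder_eq]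
  exact h1

theorem lowerMean_lt_realK (hν : NonDegenerate ν) (hb : BddAbove ν.support) {w : ℝ}
    (hw : boundB ν < w) : lowerMean ν < (realK ν w : EReal) := by
  have hanti := strictAntiOn_realK hν (ae_le_boundB hb)
  have hw1 : boundB ν < w + 1 := by linarith
  have h1 : lowerMean ν ≤ (realK ν (w + 1) : EReal) := by
    refine le_of_tendsto (tendsto_realK_lowerMean hν hb) ?_
    filter_upwards [eventually_ge_atTop (w + 1)] with u hu
    exact EReal.coe_le_coe_iff.2 (hanti.antitoneOn hw1 (hw1.trans_le hu) hu)
  exact h1.trans_lt (EReal.coe_lt_coe_iff.2 (hanti hw hw1 (lt_add_one w)))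

theorem exists_realK_eq (hν : NonDegenerate ν) (hb : BddAbove ν.support) {U m : ℝ}
    (hU : boundB ν < U) (hm : lowerMean ν < (m : EReal)) (hmU : m ≤ realK ν U) :
    ∃ w, U ≤ w ∧ realK ν w = m := by
  obtain ⟨v, hv, hUv⟩ := (((tendsto_realK_lowerMean hν hb).eventually_lt_const hm).and
    (eventually_ge_atTop U)).exists
  have hcont : ContinuousOn (realK ν) (Icc U v) :=
    (continuousOn_realK (ae_le_boundB hb)).mono fun x hx => hU.trans_le hx.1
  obtain ⟨w, hw, hwm⟩ := intermediate_value_Icc' hUv hcont ⟨(EReal.coe_lt_coe_iff.1 hv).le, hmU⟩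
  exact ⟨w, hw.1, hwm⟩

end

/-! ### Non-degeneracy and boundary values of the Boolean power -/

/-- Extremal case of `-Im G(a + i) ≤ 1`: the Poisson integrand equals `1` only at `x = a`. -/
theorem eq_dirac_of_cauchyTransform {ν : Measure ℝ} [IsProbabilityMeasure ν] {a : ℝ}
    (h : cauchyTransform ν (a + Complex.I) = 1 / Complex.I) : ν = Measure.dirac a := by
  have hz : 0 < ((a : ℂ) + Complex.I).im := by simp
  have him := im_cauchyTransform ν hz
  have hint := integrable_poisson ν hz
  simp only [Complex.add_im, Complex.ofReal_im, Complex.I_im, zero_add, Complex.add_re,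
    Complex.ofReal_re, Complex.I_re, add_zero, one_pow] at him hint
  rw [h] at him
  have h1 : ∫ x, (1 - 1 / ((a - x) ^ 2 + 1)) ∂ν = 0 := by
    rw [integral_sub (integrable_const _) hint]
    have : (1 / Complex.I).im = -1 := by simp
    rw [this] at him
    simp only [integral_const, probReal_univ, one_smul]
    linarith
  have hint2 : Integrable (fun x => 1 - 1 / ((a - x) ^ 2 + 1)) ν := (integrable_const _).sub hint
  rw [integral_eq_zero_iff_of_nonneg (fun x => ?_) hint2] at h1
  · refine eq_dirac_of_ae_eq (h1.mono fun x hx => ?_)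
    have hx : 1 - 1 / ((a - x) ^ 2 + 1) = 0 := hx
    have h2 : (a - x) ^ 2 + 1 ≠ 0 := by positivity
    field_simp at hx
    have h3 : (a - x) ^ 2 = 0 := by linarith
    have h4 := pow_eq_zero_iff two_ne_zero |>.1 h3
    linarith
  · have : 1 / ((a - x) ^ 2 + 1) ≤ 1 :=
      (div_le_one (by positivity)).2 (by nlinarith [sq_nonneg (a - x)])
    simpa using this

/-- If the dilation is `δ_a`, then `K_μ` is the constant `α a`, so `K_ν = a`; evaluation at `a + i`
makes `ν` a point mass. -/
theorem nonDegenerate_dilation {ν μ : Measure ℝ} [IsProbabilityMeasure ν] {α : ℝ} (hα : 0 < α)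
    (hν : NonDegenerate ν) (hμ : IsBooleanPow ν α μ) : NonDegenerate (dilation (1 / α) μ) := by
  intro a ha
  have h1 : μ = Measure.dirac (α * a) := by
    have := congrArg (Measure.map fun x => α * x) ha
    rw [dilation, Measure.map_map (by fun_prop) (by fun_prop),
      Measure.map_dirac' (f := fun x => α * x) (by fun_prop)] at this
    have h2 : ((fun x => α * x) ∘ fun x => 1 / α * x) = id := by
      ext x
      simp only [Function.comp_apply, id]
      field_simp
    rwa [h2, Measure.map_id] at this
  refine hν a (eq_dirac_of_cauchyTransform ?_)
  have hz : 0 < ((a : ℂ) + Complex.I).im := by simp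
  have h2 := hμ.selfEnergy_eq _ hz
  have hα' : (α : ℂ) ≠ 0 := by exact_mod_cast hα.ne'
  rw [selfEnergy, selfEnergy, h1, cauchyTransform, integral_dirac, one_div_one_div] at h2
  push_cast at h2
  have h3 : 1 / cauchyTransform ν (a + Complex.I) = Complex.I := by
    apply mul_left_cancel₀ hα'
    linear_combination h2
  rw [← one_div_one_div (cauchyTransform ν _), h3]

/-- The Poisson kernel at height `y` is at least `1 / (2y)` on the ball of radius `y`. -/
theorem measure_closedBall_le (μ : Measure ℝ) [IsProbabilityMeasure μ] (x : ℝ) {y : ℝ}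
    (hy : 0 < y) :
    μ (Metric.closedBall x y) ≤
      ENNReal.ofReal (2 * y) * ENNReal.ofReal (-(cauchyTransform μ (x + y * Complex.I)).im) := by
  have hz : 0 < ((x : ℂ) + y * Complex.I).im := by simpa using hy
  have him := im_cauchyTransform μ hz
  have hint := integrable_poisson μ hz
  simp only [Complex.add_im, Complex.ofReal_im, Complex.mul_im, Complex.ofReal_re, Complex.I_im,
    mul_one, Complex.I_re, mul_zero, add_zero, zero_add, Complex.add_re, Complex.mul_re,
    sub_self] at him hint
  have hmarkov := mul_meas_ge_le_integral_of_nonneg (μ := μ)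
    (ae_of_all _ fun t : ℝ => (by positivity : (0 : ℝ) ≤ y / ((x - t) ^ 2 + y ^ 2))) hint
    (1 / (2 * y))
  have hsub : Metric.closedBall x y ⊆ {t | 1 / (2 * y) ≤ y / ((x - t) ^ 2 + y ^ 2)} := fun t ht => by
    rw [Metric.mem_closedBall, dist_comm, Real.dist_eq] at ht
    have : (x - t) ^ 2 ≤ y ^ 2 := sq_le_sq' (abs_le.1 ht).1 (abs_le.1 ht).2
    rw [mem_ofPred_eq, div_le_div_iff₀ (by positivity) (by positivity)]
    linarith
  refine (measure_mono hsub).trans ?_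
  rw [← ENNReal.ofReal_mul (by positivity), ← ofReal_measureReal]
  refine ENNReal.ofReal_le_ofReal ?_
  rw [one_div_mul_eq_div, div_le_iff₀ (by positivity)] at hmarkov
  rw [him, neg_neg]
  linarith

/-- A weak form of the Stieltjes inversion formula: there is no mass where the imaginary part of
the Cauchy transform vanishes on the real axis. -/
theorem ae_le_of_tendsto_im {μ : Measure ℝ} [IsProbabilityMeasure μ] {W : ℝ}
    (h : ∀ x, W < x → Tendsto (fun y : ℝ => (cauchyTransform μ (x + y * Complex.I)).im)
      (𝓝[>] 0) (𝓝 0)) : ∀ᵐ x ∂μ, x ≤ W := by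
  -- At `μ`-a.e. `x` the ratio of Lebesgue measure to `μ` on shrinking balls has a finite limit. The
  -- ball estimate bounds this ratio below by `1 / (-Im G)`, which tends to `∞` when `x > W`.
  filter_upwards [Besicovitch.ae_tendsto_rnDeriv volume μ, Measure.rnDeriv_lt_top volume μ]
    with x hx hfin
  by_contra! hW
  have h1 : Tendsto (fun y : ℝ =>
      (ENNReal.ofReal (-(cauchyTransform μ (x + y * Complex.I)).im))⁻¹) (𝓝[>] 0) (𝓝 ⊤) := by
    have := (ENNReal.tendsto_ofReal (h x hW).neg).inv
    simpa using this
  refine hfin.not_ge (le_of_tendsto_of_tendsto h1 hx ?_)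
  filter_upwards [self_mem_nhdsWithin] with y hy
  have hy : 0 < y := hy
  have h2 := measure_closedBall_le μ x hy
  rw [Real.volume_closedBall]
  refine le_trans ?_ (ENNReal.div_le_div_left h2 _)
  have h3 : ENNReal.ofReal (2 * y) ≠ 0 := by simpa using hy
  rw [← one_div]
  conv_lhs => rw [← ENNReal.mul_div_mul_left 1 _ h3 ENNReal.ofReal_ne_top, mul_one]

theorem tendsto_cauchyTransform_real {ν : Measure ℝ} [IsProbabilityMeasure ν] {b w : ℝ}
    (h : ∀ᵐ x ∂ν, x ≤ b) (hw : b < w) :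
    Tendsto (fun y : ℝ => cauchyTransform ν (w + y * Complex.I)) (𝓝[>] 0)
      (𝓝 (realG ν w : ℂ)) := by
  have e : (realG ν w : ℂ) = ∫ x : ℝ, 1 / ((w : ℂ) - x) ∂ν := by
    rw [realG, ← integral_complex_ofReal]
    refine integral_congr_ae (ae_of_all _ fun x => ?_)
    push_cast
    rfl
  rw [e]
  refine tendsto_integral_filter_of_dominated_convergence (fun _ => 1 / (w - b)) ?_ ?_
    (integrable_const _) ?_
  · filter_upwards [self_mem_nhdsWithin] with y hy
    have hz : 0 < ((w : ℂ) + y * Complex.I).im := by simpa using hy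
    exact (continuous_inv_sub hz).aestronglyMeasurable
  · refine Eventually.of_forall fun y => ?_
    filter_upwards [h] with x hx
    rw [norm_div, norm_one]
    refine one_div_le_one_div_of_le (by linarith) ?_
    have h1 := Complex.abs_re_le_norm ((w : ℂ) + y * Complex.I - x)
    simp only [Complex.sub_re, Complex.add_re, Complex.ofReal_re, Complex.mul_re, Complex.I_re,
      mul_zero, Complex.ofReal_im, Complex.I_im, mul_one, sub_self, add_zero] at h1
    exact le_trans (by linarith) ((le_abs_self _).trans h1)
  · filter_upwards [h] with x hx
    have hne : (w : ℂ) - x ≠ 0 := by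
      rw [← Complex.ofReal_sub]
      exact_mod_cast (by linarith : w - x ≠ 0)
    have hc : Continuous fun y : ℝ => (w : ℂ) + y * Complex.I - x := by fun_prop
    have h1 := (hc.tendsto 0).mono_left (nhdsWithin_le_nhds (s := Ioi 0))
    simp only [Complex.ofReal_zero, zero_mul, add_zero] at h1
    exact tendsto_const_nhds.div h1 hne

theorem cauchyTransform_eq_of_isBooleanPow {ν μ : Measure ℝ} {α : ℝ} (hμ : IsBooleanPow ν α μ)
    {z : ℂ} (hz : 0 < z.im) :
    cauchyTransform μ z = ((1 - α) * z + α * (cauchyTransform ν z)⁻¹)⁻¹ := by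
  have := hμ.selfEnergy_eq z hz
  rw [selfEnergy, selfEnergy, one_div, one_div] at this
  rw [← inv_inv (cauchyTransform μ z)]
  congr 1
  linear_combination -this

/-- To the right of some point the Boolean power has no mass, and its self energy is there
`α` times that of `ν`. -/
theorem exists_realK_isBooleanPow {ν μ : Measure ℝ} [IsProbabilityMeasure ν] {α b : ℝ}
    (h : ∀ᵐ x ∂ν, x ≤ b) (hμ : IsBooleanPow ν α μ) :
    ∃ W, (∀ᵐ x ∂μ, x ≤ W) ∧ ∀ w, W < w → realK μ w = α * realK ν w := by
  have := hμ.isProbabilityMeasure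
  -- Times `w`, this is the boundary value of `1 / G_μ` at `w`. Being near `1` for large `w`, it
  -- does not vanish, so `G_μ` has a finite real boundary value.
  have hlim : Tendsto (fun w => (1 - α) + α * (w * realG ν w)⁻¹) atTop (𝓝 1) := by
    have := ((tendsto_mul_realG h).inv₀ one_ne_zero).const_mul α |>.const_add (1 - α)
    simpa using this
  obtain ⟨W, hW⟩ := eventually_atTop.1 ((hlim.eventually_ne one_ne_zero).and
    ((eventually_gt_atTop b).and (eventually_gt_atTop 0)))
  have key : ∀ w, W < w → Tendsto (fun y : ℝ => cauchyTransform μ (w + y * Complex.I)) (𝓝[>] 0)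
      (𝓝 ((((1 - α) * w + α * (realG ν w)⁻¹)⁻¹ : ℝ) : ℂ)) := by
    intro w hw
    obtain ⟨h1, h2, h3⟩ := hW w hw.le
    have hg := realG_pos h h2
    have hne : (1 - α) * w + α * (realG ν w)⁻¹ ≠ 0 := by
      intro h0
      apply h1
      rw [mul_inv]
      field_simp at h0 ⊢
      linarith
    have hc : Continuous fun y : ℝ => (w : ℂ) + y * Complex.I := by fun_prop
    have t1 := (hc.tendsto 0).mono_left (nhdsWithin_le_nhds (s := Ioi 0))
    simp only [Complex.ofReal_zero, zero_mul, add_zero] at t1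
    have t2 := (tendsto_cauchyTransform_real h h2).inv₀ (by exact_mod_cast hg.ne')
    have t3 := ((t1.const_mul (1 - (α : ℂ))).add (t2.const_mul (α : ℂ))).inv₀
      (by exact_mod_cast hne)
    push_cast
    refine t3.congr' ?_
    filter_upwards [self_mem_nhdsWithin] with y hy
    have hz : 0 < ((w : ℂ) + y * Complex.I).im := by simpa using hy
    exact (cauchyTransform_eq_of_isBooleanPow hμ hz).symm
  have hae : ∀ᵐ x ∂μ, x ≤ W := ae_le_of_tendsto_im fun x hx => by
    have := (Complex.continuous_im.tendsto _).comp (key x hx)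
    rwa [Complex.ofReal_im] at this
  refine ⟨W, hae, fun w hw => ?_⟩
  have h1 := tendsto_nhds_unique (tendsto_cauchyTransform_real hae hw) (key w hw)
  rw [realK, realK, Complex.ofReal_injective h1, one_div, inv_inv, one_div]
  ring

theorem realK_dilation (μ : Measure ℝ) {α : ℝ} (hα : 0 < α) (w : ℝ) :
    realK (dilation (1 / α) μ) w = realK μ (α * w) / α := by
  have : realG (dilation (1 / α) μ) w = α * realG μ (α * w) := by
    rw [realG, dilation, integral_map (by fun_prop)
      (measurable_one_div_sub w).aestronglyMeasurable, realG, ← integral_const_mul]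
    refine integral_congr_ae (ae_of_all _ fun x => ?_)
    have : α * w - x = α * (w - 1 / α * x) := by field_simp
    simp only [this]
    rw [mul_one_div, div_mul_cancel_left₀ hα.ne', one_div]
  rw [realK, realK, this]
  field_simp

end CSK
end

theorem mainTheorem9 (ν : MeasureTheory.Measure ℝ) [MeasureTheory.IsProbabilityMeasure ν]
    (hν : CSK.NonDegenerate ν) (hb : BddAbove ν.support) (α : ℝ) (hα : 0 < α) :
    (∃ μ : MeasureTheory.Measure ℝ, CSK.IsBooleanPow ν α μ) ∧
    ∀ μ : MeasureTheory.Measure ℝ, CSK.IsBooleanPow ν α μ →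
      CSK.NonDegenerate (CSK.dilation (1 / α) μ) ∧
      BddAbove (CSK.dilation (1 / α) μ).support ∧
      ∃ c : ℝ, CSK.lowerMean ν < (c : EReal) ∧
        ∀ m : ℝ, CSK.lowerMean ν < (m : EReal) → m < c →
          m ∈ CSK.meanDomain ν ∧ m ∈ CSK.meanDomain (CSK.dilation (1 / α) μ) ∧
          CSK.pseudoVar (CSK.dilation (1 / α) μ) m =
            CSK.pseudoVar ν m / α + (1 / α - 1) * m ^ 2 := by
  refine ⟨CSK.exists_isBooleanPow ν hα, fun μ hμ => ?_⟩
  have := hμ.isProbabilityMeasure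
  have hnd := CSK.nonDegenerate_dilation hα hν hμ
  obtain ⟨W, hW, hK⟩ := CSK.exists_realK_isBooleanPow (CSK.ae_le_boundB hb) hμ
  have hae : ∀ᵐ x ∂(CSK.dilation (1 / α) μ), x ≤ 1 / α * W := by
    rw [CSK.dilation, ae_map_iff (by fun_prop) measurableSet_Iic]
    filter_upwards [hW] with x hx
    gcongr
  have hbd := CSK.bddAbove_support hae
  have : IsProbabilityMeasure (CSK.dilation (1 / α) μ) :=
    Measure.isProbabilityMeasure_map (by fun_prop)
  refine ⟨hnd, hbd, ?_⟩
  -- Beyond `U`, `1/w` is admissible for `ν`, the relation between real self energies holds, and, by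
  -- the third bound, `α/w` is admissible for the dilated measure. The threshold `c` is `K_ν(U)`.
  obtain ⟨U, hU⟩ := exists_gt
    (max (CSK.boundB ν) (max W (α * CSK.boundB (CSK.dilation (1 / α) μ))))
  obtain ⟨hU1, hU⟩ := max_lt_iff.1 hU
  obtain ⟨hU2, hU3⟩ := max_lt_iff.1 hU
  refine ⟨CSK.realK ν U, CSK.lowerMean_lt_realK hν hb hU1, fun m hm hmU => ?_⟩
  obtain ⟨w, hUw, rfl⟩ := CSK.exists_realK_eq hν hb hU1 hm hmU.le
  have h1 : CSK.boundB ν < w := hU1.trans_le hUw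
  have h2 : CSK.boundB (CSK.dilation (1 / α) μ) < w / α := by
    rw [lt_div_iff₀ hα, mul_comm]
    exact hU3.trans_le hUw
  have h3 : CSK.realK ν w = CSK.realK (CSK.dilation (1 / α) μ) (w / α) := by
    rw [CSK.realK_dilation μ hα, mul_div_cancel₀ _ hα.ne', hK w (hU2.trans_le hUw),
      mul_div_cancel_left₀ _ hα.ne']
  refine ⟨CSK.realK_mem_meanDomain hb h1, h3 ▸ CSK.realK_mem_meanDomain hbd h2, ?_⟩
  rw [CSK.pseudoVar_realK hν hb h1, h3, CSK.pseudoVar_realK hnd hbd h2]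
  ring
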